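/- Let $n,k,s$ be positive integers with $n\ge 10000\,s^5k$, write $[n]=\{1,\dots,n\}$, and let $\binom{[n]}{k}$ be the family of all $k$-element subsets of $[n]$. For $i\in[n]$, the star with centre $i$ is $\mathcal D_i=\{A\in\binom{[n]}{k}: i\in A\}$. The Kneser graph $K(n,k)$ has vertex set $\binom{[n]}{k}$, two sets being adjacent if and only if they are disjoint. Let $\mathcal F\subseteq\binom{[n]}{k}$ be a family whose size is greater than that of a union of $s$ distinct stars, i.e. $|\mathcal F|>\left|\bigcup_{i\in S}\mathcal D_i\right|$ for some $S\subseteq[n]$ with $|S|=s$ (this size is $\binom nk-\binom{n-s}k$ for every such $S$). Then $\mathcal F$ contains $s+1$ pairwise disjoint sets; that is, the induced subgraph $K(n,k)[\mathcal F]$ contains a clique of size $s+1$. -/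

import Mathlib

/-- The Kneser graph `K(n, k)`: the vertices are the `k`-element subsets of an `n`-element set, and
two (distinct) vertices are adjacent iff they are disjoint as sets. Distinctness only matters for
`k = 0`. -/
def kneserGraph (n k : ℕ) : SimpleGraph {A : Finset (Fin n) // A.card = k} where
  Adj A B := A ≠ B ∧ Disjoint A.1 B.1
  symm := ⟨fun _ _ h => ⟨h.1.symm, h.2.symm⟩⟩
  loopless := ⟨fun _ h => h.1 rfl⟩

/-- The star centred at `i`: all the `k`-element subsets of the ground set that contain `i`. -/
def kneserStar (n k : ℕ) (i : Fin n) : Finset (Finset (Fin n)) :=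
  (Finset.univ.powersetCard k).filter fun A => i ∈ A

/-- The union of the stars centred at the points of `S`. -/
def unionOfStars (n k : ℕ) (S : Finset (Fin n)) : Finset (Finset (Fin n)) :=
  S.biUnion (kneserStar n k)

/-- A matching is a family of pairwise disjoint sets. -/
def IsMatchingFamily {n : ℕ} (M : Finset (Finset (Fin n))) : Prop :=
  ∀ A ∈ M, ∀ B ∈ M, A ≠ B → Disjoint A B

open Finset

/-! Only `(2 * s + 1) * k ≤ n` is used, and the argument is Frankl's. Shifting keeps the size of a
family and creates no new matching number, so let `𝒜` be shifted without `s + 1` disjoint members,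
and let `R` be the first `s + 1` points. Compare `𝒜` with the union `E` of the stars at the first
`s` points, according to the size of the trace on `R`. Members with at least two points in `R` all
lie in `E`. Those meeting `R` exactly in `r` are counted by a link `F r` outside `R`, and
shiftedness makes the links decrease in `r`. A member missing `R` can trade any point for `s`, so
its shadow lies in `F s`; by `card_le_mul_card_shadow` there are at most `s * #(F s)` such members.
It remains to bound `∑ r < s, #(F r) + (s + 1) * #(F s)` by `s * m.choose l`, where `m = n - s - 1`
and `l = k - 1`, which is the number of members of `E` with one point in `R`. This is
`sum_card_add_mul_card_le`: disjoint representatives of `F 0, …, F s` would give a matching in `𝒜`,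
and averaging over random placements of `2 * s + 1` disjoint blocks turns their absence into the
bound. -/

/-- `𝒜` contains `m` pairwise disjoint members, indexed by `Fin m`. -/
def HasMatching {α : Type*} (𝒜 : Finset (Finset α)) (m : ℕ) : Prop :=
  ∃ f : Fin m → Finset α, (∀ i, f i ∈ 𝒜) ∧ Pairwise fun i j => Disjoint (f i) (f j)

/-- `𝒜` is closed under replacing an element by a smaller one that is at least `a`. -/
def ShiftedFrom (a : ℕ) (𝒜 : Finset (Finset ℕ)) : Prop :=
  ∀ A ∈ 𝒜, ∀ i j, a ≤ i → i < j → j ∈ A → i ∉ A → insert i (A.erase j) ∈ 𝒜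

/-! ### Shifting -/

theorem map_swap_eq_insert_erase {α : Type*} [DecidableEq α] {A : Finset α} {i j : α}
    (hj : j ∈ A) (hi : i ∉ A) :
    A.map (Equiv.swap i j).toEmbedding = insert i (A.erase j) := by
  ext x
  simp only [mem_map_equiv, Equiv.symm_swap, mem_insert, mem_erase]
  rcases eq_or_ne x i with rfl | hxi
  · simp [hj]
  · rcases eq_or_ne x j with rfl | hxj
    · simp [hi, hxi]
    · simp [Equiv.swap_apply_of_ne_of_ne hxi hxj, hxi, hxj]

theorem map_swap_eq_self {α : Type*} [DecidableEq α] {A : Finset α} {i j : α}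
    (hj : j ∉ A) (hi : i ∉ A) : A.map (Equiv.swap i j).toEmbedding = A := by
  ext x
  simp only [mem_map_equiv, Equiv.symm_swap]
  rcases eq_or_ne x i with rfl | hxi
  · simp [hj, hi]
  · rcases eq_or_ne x j with rfl | hxj
    · simp [hi, hj]
    · simp [Equiv.swap_apply_of_ne_of_ne hxi hxj]

theorem map_swap_map_swap {α : Type*} [DecidableEq α] (A : Finset α) (i j : α) :
    (A.map (Equiv.swap i j).toEmbedding).map (Equiv.swap i j).toEmbedding = A := by
  ext x
  simp [mem_map_equiv]

open Classical in
/-- The `(i, j)`-shift of a member `A` of the family `𝒜`. -/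
noncomputable def shiftSet (i j : ℕ) (𝒜 : Finset (Finset ℕ)) (A : Finset ℕ) : Finset ℕ :=
  if j ∈ A ∧ i ∉ A ∧ A.map (Equiv.swap i j).toEmbedding ∉ 𝒜 then
    A.map (Equiv.swap i j).toEmbedding else A

theorem shiftSet_injOn (i j : ℕ) (𝒜 : Finset (Finset ℕ)) :
    Set.InjOn (shiftSet i j 𝒜) 𝒜 := by
  intro A hA B hB h
  unfold shiftSet at h
  split_ifs at h with h1 h2 h2
  · exact map_injective _ h
  · exact absurd (h ▸ hB) h1.2.2
  · exact absurd (h ▸ hA) h2.2.2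
  · exact h

/-- Applying the swap to the whole matching brings it back into `𝒜`. New members contain `i`, so
there is only one; every other member misses `i`, and either misses `j` and is fixed, or contains
`j` and was left unshifted because its swap already lies in `𝒜`. -/
theorem not_hasMatching_shift {i j : ℕ} {𝒜 : Finset (Finset ℕ)} {m : ℕ}
    (h : ¬ HasMatching 𝒜 m) : ¬ HasMatching (𝒜.image (shiftSet i j 𝒜)) m := by
  rintro ⟨f, hf, hd⟩
  by_cases hall : ∀ q, f q ∈ 𝒜
  · exact h ⟨f, hall, hd⟩
  push Not at hall
  obtain ⟨p, hp⟩ := hall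
  have key : ∀ q, f q ∉ 𝒜 → i ∈ f q ∧ (f q).map (Equiv.swap i j).toEmbedding ∈ 𝒜 := by
    intro q hq
    obtain ⟨A, hA, hAq⟩ := mem_image.1 (hf q)
    unfold shiftSet at hAq
    split_ifs at hAq with h1
    · refine ⟨?_, ?_⟩
      · rw [← hAq, map_swap_eq_insert_erase h1.1 h1.2.1]
        exact mem_insert_self _ _
      · rw [← hAq, map_swap_map_swap]
        exact hA
    · exact absurd (hAq ▸ hA) hq
  refine h ⟨fun q => (f q).map (Equiv.swap i j).toEmbedding, fun q => ?_, fun q r hqr => ?_⟩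
  · by_cases hq : f q ∈ 𝒜
    · have hqp : q ≠ p := by
        rintro rfl
        exact hp hq
      have hi : i ∉ f q := fun hi => disjoint_left.1 (hd hqp) hi (key p hp).1
      by_cases hj : j ∈ f q
      · obtain ⟨A, hA, hAq⟩ := mem_image.1 (hf q)
        unfold shiftSet at hAq
        split_ifs at hAq with h1
        · exact absurd (hAq ▸ hq) h1.2.2
        · rw [hAq] at h1
          by_contra hn
          exact h1 ⟨hj, hi, hn⟩
      · simpa only [map_swap_eq_self hj hi] using hq
    · exact (key q hq).2
  · exact (disjoint_map _).2 (hd hqr)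

/-- Every family without `m` pairwise disjoint members can be shifted. -/
theorem exists_shiftedFrom {n k m : ℕ} {𝒜 : Finset (Finset ℕ)}
    (h𝒜 : 𝒜 ⊆ (range n).powersetCard k) (hm : ¬ HasMatching 𝒜 m) :
    ∃ ℬ ⊆ (range n).powersetCard k, ¬ HasMatching ℬ m ∧ #ℬ = #𝒜 ∧ ShiftedFrom 0 ℬ := by
  classical
  -- Minimising the total sum of elements forces shiftedness: a shift that moved some member would
  -- lower the sum.
  obtain ⟨ℬ, hℬ, hmin⟩ := Finset.exists_min_image
    ((((range n).powersetCard k).powerset).filter fun ℬ => ¬ HasMatching ℬ m ∧ #ℬ = #𝒜)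
    (fun ℬ => ∑ A ∈ ℬ, ∑ x ∈ A, x) ⟨𝒜, by simp [h𝒜, hm]⟩
  simp only [mem_filter, mem_powerset] at hℬ hmin
  obtain ⟨hsub, hno, hcard⟩ := hℬ
  refine ⟨ℬ, hsub, hno, hcard, ?_⟩
  intro A hA i j _ hij hj hi
  by_contra hcon
  have hlt : ∀ B : Finset ℕ, j ∈ B → i ∉ B →
      ∑ x ∈ B.map (Equiv.swap i j).toEmbedding, x < ∑ x ∈ B, x := by
    intro B hjB hiB
    rw [map_swap_eq_insert_erase hjB hiB, sum_insert (by simp [hiB]),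
      ← add_sum_erase B (fun x => x) hjB]
    omega
  have hle : ∀ B ∈ ℬ, ∑ x ∈ shiftSet i j ℬ B, x ≤ ∑ x ∈ B, x := by
    intro B _
    unfold shiftSet
    split_ifs with h1
    · exact (hlt B h1.1 h1.2.1).le
    · exact le_rfl
  have := hmin (ℬ.image (shiftSet i j ℬ)) ⟨?_, not_hasMatching_shift hno, ?_⟩
  · rw [sum_image (shiftSet_injOn i j ℬ)] at this
    refine absurd this (not_le.2 (sum_lt_sum hle ⟨A, hA, ?_⟩))
    rw [← map_swap_eq_insert_erase hj hi] at hcon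
    unfold shiftSet
    rw [if_pos ⟨hj, hi, hcon⟩]
    exact hlt A hj hi
  · intro C hC
    obtain ⟨B, hB, rfl⟩ := mem_image.1 hC
    have hB' := mem_powersetCard.1 (hsub hB)
    unfold shiftSet
    split_ifs with h1
    · refine mem_powersetCard.2 ⟨?_, by rw [card_map, hB'.2]⟩
      rw [map_swap_eq_insert_erase h1.1 h1.2.1]
      refine insert_subset (mem_range.2 (hij.trans (mem_range.1 (hB'.1 h1.1)))) ?_
      exact (erase_subset _ _).trans hB'.1
    · exact hsub hB
  · rw [card_image_of_injOn (shiftSet_injOn i j ℬ), hcard]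

theorem HasMatching.mono {α : Type*} {𝒜 ℬ : Finset (Finset α)} {m : ℕ} (h : HasMatching 𝒜 m)
    (hsub : 𝒜 ⊆ ℬ) : HasMatching ℬ m :=
  let ⟨f, hf, hd⟩ := h
  ⟨f, fun i => hsub (hf i), hd⟩

/-! ### Shadows of shifted families -/

/-- Double counting of inclusions: a member has `k + 1` subsets in the shadow, and a `k`-subset of
`U` has at most `#U - k` extensions within `U`. -/
theorem card_mul_le_card_shadow_mul_of_subset_powersetCard {α : Type*} [DecidableEq α]
    {U : Finset α} {k : ℕ} {𝒜 : Finset (Finset α)} (h𝒜 : 𝒜 ⊆ U.powersetCard (k + 1)) :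
    #𝒜 * (k + 1) ≤ #𝒜.shadow * (#U - k) := by
  classical
  refine card_mul_le_card_mul' (fun A B => A ⊆ B) (fun B hB => ?_) (fun A hA => ?_)
  · have hB' := mem_powersetCard.1 (h𝒜 hB)
    rw [← hB'.2, ← card_image_of_injOn B.erase_injOn]
    refine card_le_card fun A hA => ?_
    obtain ⟨x, hx, rfl⟩ := mem_image.1 hA
    exact (mem_bipartiteBelow _).2 ⟨erase_mem_shadow hB hx, erase_subset _ _⟩
  · obtain ⟨x, hx, hxA⟩ := mem_shadow_iff_insert_mem.1 hA
    have hxA' := mem_powersetCard.1 (h𝒜 hxA)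
    have hAU : A ⊆ U := (subset_insert _ _).trans hxA'.1
    have hAc : #A = k := by
      have := hxA'.2
      rw [card_insert_of_notMem hx] at this
      omega
    rw [← hAc, ← card_sdiff_of_subset hAU]
    refine (card_le_card fun B hB => ?_).trans (card_image_le (f := fun y => insert y A))
    obtain ⟨hB, hAB⟩ := (mem_bipartiteAbove _).1 hB
    have hB' := mem_powersetCard.1 (h𝒜 hB)
    have h1 : #(B \ A) = 1 := by
      rw [card_sdiff_of_subset hAB]
      omega
    obtain ⟨y, hy⟩ := card_eq_one.1 h1
    have hyB : y ∈ B \ A := hy ▸ mem_singleton_self y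
    refine mem_image.2 ⟨y, mem_sdiff.2 ⟨hB'.1 (mem_sdiff.1 hyB).1, (mem_sdiff.1 hyB).2⟩, ?_⟩
    rw [insert_eq, ← hy, sdiff_union_of_subset hAB]

/-- A shifted family of sets in an interval, without `s + 1` pairwise disjoint members, has at most
`s` times as many members as its shadow. -/
theorem card_le_mul_card_shadow {a s : ℕ} (d : ℕ) : ∀ {k : ℕ} {𝒜 : Finset (Finset ℕ)},
    𝒜 ⊆ (Ico a (a + d)).powersetCard k → ShiftedFrom a 𝒜 → ¬ HasMatching 𝒜 (s + 1) →
    #𝒜 ≤ s * #𝒜.shadow := by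
  induction d with
  | zero =>
    intro k 𝒜 h𝒜 _ hm
    rcases 𝒜.eq_empty_or_nonempty with rfl | ⟨A, hA⟩
    · simp
    · have : A = ∅ := by simpa using (mem_powersetCard.1 (h𝒜 hA)).1
      subst this
      -- The empty set is disjoint from itself, so repeating it gives an indexed matching of any
      -- size.
      exact absurd ⟨fun _ => ∅, fun _ => hA, fun _ _ _ => disjoint_empty_left _⟩ hm
  | succ d ih =>
    intro k 𝒜 h𝒜 hsh hm
    rcases Nat.eq_zero_or_pos k with rfl | hk
    · rcases 𝒜.eq_empty_or_nonempty with rfl | ⟨A, hA⟩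
      · simp
      · have : A = ∅ := card_eq_zero.1 (mem_powersetCard.1 (h𝒜 hA)).2
        subst this
        exact absurd ⟨fun _ => ∅, fun _ => hA, fun _ _ _ => disjoint_empty_left _⟩ hm
    obtain ⟨k, rfl⟩ : ∃ l, k = l + 1 := ⟨k - 1, by omega⟩
    -- On fewer than `(s + 1) * (k + 1)` points double counting suffices; on more, there is room to
    -- split off the last point `z` and induct on `ℬ` (members avoiding `z`) and `ℒ` (the link of
    -- `z`).
    rcases Nat.lt_or_ge (d + 1) ((s + 1) * (k + 1)) with hd | hd
    · have h1 := card_mul_le_card_shadow_mul_of_subset_powersetCard h𝒜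
      have h2 : #(Ico a (a + (d + 1))) - k ≤ s * (k + 1) := by
        rw [Nat.card_Ico]
        have : (s + 1) * (k + 1) = s * (k + 1) + (k + 1) := by ring
        omega
      have h3 := h1.trans (Nat.mul_le_mul_left _ h2)
      refine Nat.le_of_mul_le_mul_right (c := k + 1) ?_ (Nat.succ_pos k)
      calc _ ≤ _ := h3
        _ = _ := by ring
    · set z := a + d with hz
      set ℬ := 𝒜.filter (fun A => z ∉ A) with hℬ
      set 𝒞 := 𝒜.filter (fun A => z ∈ A) with h𝒞
      set ℒ := 𝒞.image (fun A => A.erase z) with hℒ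
      have hinj : Set.InjOn (fun A : Finset ℕ => A.erase z) 𝒞 := by
        intro A hA B hB h
        have hA' := (mem_filter.1 (mem_coe.1 hA)).2
        have hB' := (mem_filter.1 (mem_coe.1 hB)).2
        rw [← insert_erase hA', ← insert_erase hB']
        exact congrArg _ h
      have hlink : ∀ B, B ∈ ℒ ↔ z ∉ B ∧ insert z B ∈ 𝒜 := by
        intro B
        simp only [hℒ, h𝒞, mem_image, mem_filter]
        constructor
        · rintro ⟨A, ⟨hA, hzA⟩, rfl⟩
          exact ⟨notMem_erase _ _, by rwa [insert_erase hzA]⟩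
        · rintro ⟨h1, h2⟩
          exact ⟨_, ⟨h2, mem_insert_self _ _⟩, erase_insert h1⟩
      have hico : ∀ x, x ∈ Ico a (a + (d + 1)) → x ≠ z → x ∈ Ico a (a + d) := by
        intro x hx hxz
        simp only [mem_Ico] at hx ⊢
        omega
      have hbd : ∀ A ∈ 𝒜, ∀ x ∈ A, x ∈ Ico a (a + (d + 1)) :=
        fun A hA x hx => (mem_powersetCard.1 (h𝒜 hA)).1 hx
      have hℬsub : ℬ ⊆ (Ico a (a + d)).powersetCard (k + 1) := by
        intro A hA
        obtain ⟨hA, hzA⟩ := mem_filter.1 hA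
        refine mem_powersetCard.2 ⟨fun x hx => hico x (hbd A hA x hx) ?_,
          (mem_powersetCard.1 (h𝒜 hA)).2⟩
        rintro rfl
        exact hzA hx
      have hℒsub : ℒ ⊆ (Ico a (a + d)).powersetCard k := by
        intro B hB
        obtain ⟨hzB, hB⟩ := (hlink B).1 hB
        refine mem_powersetCard.2 ⟨fun x hx => hico x (hbd _ hB x (mem_insert_of_mem hx)) ?_, ?_⟩
        · rintro rfl
          exact hzB hx
        · have := (mem_powersetCard.1 (h𝒜 hB)).2
          rw [card_insert_of_notMem hzB] at this
          omega
      have hℬsh : ShiftedFrom a ℬ := by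
        intro A hA i j hai hij hj hi
        have hjz := mem_Ico.1 ((mem_powersetCard.1 (hℬsub hA)).1 hj)
        obtain ⟨hA, hzA⟩ := mem_filter.1 hA
        refine mem_filter.2 ⟨hsh A hA i j hai hij hj hi, ?_⟩
        simp only [mem_insert, mem_erase, not_or, not_and]
        exact ⟨by omega, fun _ => hzA⟩
      have hℒsh : ShiftedFrom a ℒ := by
        intro B hB i j hai hij hj hi
        have hjz := mem_Ico.1 ((mem_powersetCard.1 (hℒsub hB)).1 hj)
        obtain ⟨hzB, hB⟩ := (hlink B).1 hB
        have hiz : i ≠ z := by omega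
        have hzj : z ≠ j := by omega
        refine (hlink _).2 ⟨by simp [hzB, hiz.symm], ?_⟩
        have := hsh _ hB i j hai hij (mem_insert_of_mem hj) (by simp [hi, hiz])
        rwa [erase_insert_of_ne hzj, insert_comm] at this
      -- A matching in the link covers only `(s + 1) * k` points, leaving `s + 1` free ones. Each
      -- link set has its missing `z` replaced by its own free point, by shiftedness, which gives a
      -- matching in `𝒜`.
      have hℒm : ¬ HasMatching ℒ (s + 1) := by
        rintro ⟨f, hf, hdis⟩
        have hU : (univ.biUnion f) ⊆ Ico a (a + (d + 1)) := by
          intro x hx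
          obtain ⟨q, _, hx⟩ := mem_biUnion.1 hx
          exact hbd _ ((hlink _).1 (hf q)).2 x (mem_insert_of_mem hx)
        have hUc : #(univ.biUnion f) ≤ (s + 1) * k := by
          refine (card_biUnion_le_card_mul _ _ k fun q _ =>
            ((mem_powersetCard.1 (hℒsub (hf q))).2).le).trans ?_
          simp
        have hfree : s + 1 ≤ #(Ico a (a + (d + 1)) \ univ.biUnion f) := by
          rw [card_sdiff_of_subset hU, Nat.card_Ico]
          have : (s + 1) * (k + 1) = (s + 1) * k + (s + 1) := by ring
          omega
        obtain ⟨e⟩ := Function.Embedding.nonempty_of_card_le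
          (α := Fin (s + 1)) (β := ↥(Ico a (a + (d + 1)) \ univ.biUnion f)) (by simpa using hfree)
        have he : ∀ q r, (e q : ℕ) ∉ f r := fun q r h =>
          (mem_sdiff.1 (e q).2).2 (mem_biUnion.2 ⟨r, mem_univ _, h⟩)
        refine hm ⟨fun q => insert (e q : ℕ) (f q), fun q => ?_, fun q r hqr => ?_⟩
        · obtain ⟨hzf, hfq⟩ := (hlink _).1 (hf q)
          have heq := mem_Ico.1 (mem_sdiff.1 (e q).2).1
          rcases eq_or_ne (e q : ℕ) z with hez | hez
          · simpa only [hez] using hfq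
          · have := hsh _ hfq (e q) z heq.1 (by omega) (mem_insert_self _ _)
              (by simp [he, hez])
            rwa [erase_insert hzf] at this
        · have hne : (e q : ℕ) ≠ e r := fun h => hqr (e.injective (Subtype.ext h))
          simp only [disjoint_insert_left, disjoint_insert_right, mem_insert, not_or]
          exact ⟨⟨hne.symm, he _ _⟩, he _ _, hdis hqr⟩
      have hℬm : ¬ HasMatching ℬ (s + 1) := fun h => hm (h.mono (filter_subset _ _))
      have h1 := ih hℬsub hℬsh hℬm
      have h2 := ih hℒsub hℒsh hℒm
      have hcard : #𝒜 = #ℬ + #ℒ := by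
        rw [hℒ, card_image_of_injOn hinj, add_comm]
        exact (card_filter_add_card_filter_not (fun A => z ∈ A)).symm
      -- The shadow of `ℬ` avoids `z`, while adjoining `z` to the shadow of `ℒ` gives shadow sets
      -- that contain it.
      have hshadow : #ℬ.shadow + #ℒ.shadow ≤ #𝒜.shadow := by
        have hz : ∀ B ∈ ℒ.shadow, z ∉ B := by
          intro B hB hzB
          obtain ⟨x, _, hx⟩ := mem_shadow_iff_insert_mem.1 hB
          exact ((hlink _).1 hx).1 (mem_insert_of_mem hzB)
        have hinj' : Set.InjOn (fun B : Finset ℕ => insert z B) ℒ.shadow := by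
          intro A hA B hB h
          rw [← erase_insert (hz A hA), ← erase_insert (hz B hB)]
          exact congrArg (fun C : Finset ℕ => C.erase z) h
        rw [← card_image_of_injOn hinj', ← card_union_of_disjoint]
        · refine card_le_card (union_subset (shadow_mono (filter_subset _ _)) ?_)
          intro C hC
          obtain ⟨B, hB, rfl⟩ := mem_image.1 hC
          have hzB := hz B hB
          obtain ⟨x, hxB, hx⟩ := mem_shadow_iff_insert_mem.1 hB
          obtain ⟨hzx, hx⟩ := (hlink _).1 hx
          rw [insert_comm] at hx
          refine mem_shadow_iff_insert_mem.2 ⟨x, ?_, hx⟩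
          simp only [mem_insert, not_or] at hzx ⊢
          exact ⟨fun h => hzx.1 h.symm, hxB⟩
        · refine disjoint_left.2 fun C hC hC' => ?_
          obtain ⟨B, hB, rfl⟩ := mem_image.1 hC'
          obtain ⟨x, _, hx⟩ := mem_shadow_iff_insert_mem.1 hC
          exact (mem_filter.1 hx).2 (mem_insert_of_mem (mem_insert_self _ _))
      calc #𝒜 = #ℬ + #ℒ := hcard
        _ ≤ s * #ℬ.shadow + s * #ℒ.shadow := add_le_add h1 h2
        _ = s * (#ℬ.shadow + #ℒ.shadow) := by ring
        _ ≤ s * #𝒜.shadow := Nat.mul_le_mul_left _ hshadow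

/-! ### Averaging over permutations -/

theorem exists_perm_map_eq {α : Type*} [Fintype α] [DecidableEq α] {A B : Finset α}
    (h : #A = #B) : ∃ σ : Equiv.Perm α, A.map σ.toEmbedding = B := by
  let e : {x // x ∈ A} ≃ {x // x ∈ B} := Finset.equivOfCardEq h
  refine ⟨e.extendSubtype, eq_of_subset_of_card_le (fun x hx => ?_) (by rw [card_map, h])⟩
  obtain ⟨y, hy, rfl⟩ := mem_map.1 hx
  exact e.extendSubtype_mem y hy

/-- The proportion of permutations that send a fixed `l`-set into `𝒜` is the density of `𝒜`. -/
theorem card_perm_map_mem_mul_choose {α : Type*} [Fintype α] [DecidableEq α] {l : ℕ}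
    {𝒜 : Finset (Finset α)} (h𝒜 : 𝒜 ⊆ univ.powersetCard l) {B : Finset α} (hB : #B = l) :
    #{σ : Equiv.Perm α | B.map σ.toEmbedding ∈ 𝒜} * (Fintype.card α).choose l =
      Fintype.card (Equiv.Perm α) * #𝒜 := by
  -- Right translation by a permutation taking `B` to `C` shows that the count does not depend on
  -- the `l`-set; both sides then come from counting pairs `(C, σ)`.
  have hconst : ∀ C ∈ (univ : Finset α).powersetCard l,
      #{σ : Equiv.Perm α | C.map σ.toEmbedding ∈ 𝒜} =
        #{σ : Equiv.Perm α | B.map σ.toEmbedding ∈ 𝒜} := by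
    intro C hC
    obtain ⟨τ, rfl⟩ := exists_perm_map_eq (hB.trans (mem_powersetCard.1 hC).2.symm)
    refine card_bij (fun σ _ => σ * τ) (fun σ hσ => ?_) (fun σ _ ρ _ h => mul_right_cancel h)
      fun σ hσ => ⟨σ * τ⁻¹, ?_, by simp⟩
    · simp only [mem_filter, mem_univ, true_and, map_map] at hσ ⊢
      exact hσ
    · simp only [mem_filter, mem_univ, true_and, map_map] at hσ ⊢
      convert hσ using 2
      ext x
      simp
  have hcol : ∀ σ : Equiv.Perm α,
      #{C ∈ (univ : Finset α).powersetCard l | C.map σ.toEmbedding ∈ 𝒜} = #𝒜 := by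
    intro σ
    refine card_bij (fun C _ => C.map σ.toEmbedding) (fun C hC => (mem_filter.1 hC).2)
      (fun C _ D _ h => map_injective _ h) fun D hD => ?_
    have hDD : (D.map σ.symm.toEmbedding).map σ.toEmbedding = D := by
      ext x
      simp [mem_map_equiv]
    refine ⟨D.map σ.symm.toEmbedding, mem_filter.2 ⟨?_, by rwa [hDD]⟩, hDD⟩
    exact mem_powersetCard.2 ⟨subset_univ _, by rw [card_map, (mem_powersetCard.1 (h𝒜 hD)).2]⟩
  have hdc := sum_card_bipartiteAbove_eq_sum_card_bipartiteBelow
    (s := (univ : Finset α).powersetCard l) (t := (univ : Finset (Equiv.Perm α)))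
    (fun C σ => C.map σ.toEmbedding ∈ 𝒜)
  simp only [bipartiteAbove, bipartiteBelow] at hdc
  rw [sum_congr rfl hconst, sum_congr rfl fun σ _ => hcol σ] at hdc
  simp only [sum_const, card_powersetCard, card_univ, smul_eq_mul] at hdc
  rw [mul_comm, hdc]

theorem exists_pairwise_disjoint_card_eq {α : Type*} [Fintype α] [DecidableEq α] {N l : ℕ}
    (h : N * l ≤ Fintype.card α) : ∃ B : Fin N → Finset α,
      (∀ j, #(B j) = l) ∧ Pairwise fun i j => Disjoint (B i) (B j) := by
  obtain ⟨e⟩ := Function.Embedding.nonempty_of_card_le (α := Fin N × Fin l) (β := α) (by simpa)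
  refine ⟨fun j => univ.image fun x => e (j, x), fun j => ?_, fun i j hij => ?_⟩
  · rw [card_image_of_injective _ fun x y h => by simpa using e.injective h]
    simp
  · refine disjoint_left.2 fun x hx hx' => hij ?_
    obtain ⟨y, _, rfl⟩ := mem_image.1 hx
    obtain ⟨z, _, hz⟩ := mem_image.1 hx'
    exact (congrArg Prod.fst (e.injective hz)).symm

/-- Hall's condition holds because an index set with least element `t` has at most `s + 1 - t`
elements, and `J t` alone is that large. -/
theorem exists_injective_mem_of_le_card {β : Type*} [DecidableEq β] {s : ℕ}
    (J : Fin (s + 1) → Finset β) (hJ : ∀ i : Fin (s + 1), s + 1 - i ≤ #(J i)) :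
    ∃ g : Fin (s + 1) → β, Function.Injective g ∧ ∀ i, g i ∈ J i := by
  refine (Finset.all_card_le_biUnion_card_iff_exists_injective J).1 fun T => ?_
  rcases T.eq_empty_or_nonempty with rfl | hT
  · simp
  · calc #T ≤ #(Ici (T.min' hT)) := card_le_card fun x hx => mem_Ici.2 (T.min'_le x hx)
      _ = s + 1 - (T.min' hT : ℕ) := by simp
      _ ≤ #(J (T.min' hT)) := hJ _
      _ ≤ _ := card_le_card (subset_biUnion_of_mem J (T.min'_mem hT))

/-- With `d = s - i`, the first `i` terms are at most `2 * s + 1` and all later ones at most `d`.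
The total is at most `i * (2 * s + 1) + d * (d + s + 1)`, and `d + s + 1 ≤ 2 * s + 1`; this explains
the number of blocks. -/
theorem sum_add_mul_le_of_antitone {s i : ℕ} {t : ℕ → ℕ} (ht : Antitone t)
    (hN : ∀ r, t r ≤ 2 * s + 1) (hi : i ≤ s) (hti : t i ≤ s - i) :
    ∑ r ∈ range s, t r + (s + 1) * t s ≤ s * (2 * s + 1) := by
  obtain ⟨d, rfl⟩ := Nat.exists_eq_add_of_le hi
  have h1 : ∑ r ∈ range i, t r ≤ i * (2 * (i + d) + 1) := by
    simpa using sum_le_card_nsmul (range i) t _ fun r _ => hN r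
  have h2 : ∑ r ∈ range d, t (i + r) ≤ d * d := by
    simpa using sum_le_card_nsmul (range d) (fun r => t (i + r)) d fun r _ =>
      (ht (Nat.le_add_right i r)).trans (hti.trans (by omega))
  have h3 : t (i + d) ≤ d := (ht (Nat.le_add_right i d)).trans (hti.trans (by omega))
  rw [sum_range_add]
  nlinarith [Nat.mul_le_mul_left (i + d + 1) h3]

/-- Frankl's inequality for a decreasing sequence of families with no transversal of pairwise
disjoint members. -/
theorem sum_card_add_mul_card_le {α : Type*} [Fintype α] [DecidableEq α] {s l : ℕ}
    (hα : (2 * s + 1) * l ≤ Fintype.card α) {F : ℕ → Finset (Finset α)} (hF : Antitone F)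
    (hl : ∀ r, F r ⊆ univ.powersetCard l)
    (hcross : ¬ ∃ f : Fin (s + 1) → Finset α, (∀ i : Fin (s + 1), f i ∈ F i) ∧
      Pairwise fun i j => Disjoint (f i) (f j)) :
    ∑ r ∈ range s, #(F r) + (s + 1) * #(F s) ≤ s * (Fintype.card α).choose l := by
  obtain ⟨B, hBc, hBd⟩ := exists_pairwise_disjoint_card_eq hα
  have hσ : ∀ σ : Equiv.Perm α,
      ∑ r ∈ range s, #{j | (B j).map σ.toEmbedding ∈ F r} +
        (s + 1) * #{j | (B j).map σ.toEmbedding ∈ F s} ≤ s * (2 * s + 1) := by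
    intro σ
    -- Otherwise distinct blocks could be chosen for all `s + 1` families, and their images would be
    -- the forbidden disjoint representatives.
    obtain ⟨i, hi, hti⟩ : ∃ i ≤ s, #{j | (B j).map σ.toEmbedding ∈ F i} ≤ s - i := by
      by_contra! hcon
      obtain ⟨g, hg, hgJ⟩ := exists_injective_mem_of_le_card
        (fun i : Fin (s + 1) => ({j | (B j).map σ.toEmbedding ∈ F i} : Finset (Fin (2 * s + 1))))
        (fun i => by have := hcon i (by omega); omega)
      refine hcross ⟨fun i => (B (g i)).map σ.toEmbedding, fun i => ?_, fun i j hij => ?_⟩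
      · simpa using hgJ i
      · exact (disjoint_map _).2 (hBd (hg.ne hij))
    refine sum_add_mul_le_of_antitone (t := fun r => #{j | (B j).map σ.toEmbedding ∈ F r})
      (fun r r' h => card_le_card fun j hj => ?_) (fun r => ?_) hi hti
    · simp only [mem_filter, mem_univ, true_and] at hj ⊢
      exact hF h hj
    · exact (card_le_univ _).trans (by simp)
  set P := Fintype.card (Equiv.Perm α) with hP
  set c := (Fintype.card α).choose l with hc
  -- Each block is sent to a uniformly random `l`-set, so on average `(2 * s + 1) * #(F r) / c` of
  -- the blocks land in `F r`.
  have havg : ∀ r, (∑ σ : Equiv.Perm α, #{j | (B j).map σ.toEmbedding ∈ F r}) * c =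
      P * (2 * s + 1) * #(F r) := by
    intro r
    have hdc := sum_card_bipartiteAbove_eq_sum_card_bipartiteBelow
      (s := (univ : Finset (Equiv.Perm α))) (t := (univ : Finset (Fin (2 * s + 1))))
      (fun σ j => (B j).map σ.toEmbedding ∈ F r)
    simp only [bipartiteAbove, bipartiteBelow] at hdc
    rw [hdc, sum_mul, sum_congr rfl fun j _ => card_perm_map_mem_mul_choose (hl r) (hBc j)]
    simp only [sum_const, card_univ, Fintype.card_fin, smul_eq_mul]
    ring
  have hsum := sum_le_sum fun σ (_ : σ ∈ (univ : Finset (Equiv.Perm α))) => hσ σ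
  rw [sum_add_distrib, sum_comm, ← mul_sum, sum_const, card_univ, smul_eq_mul, ← hP] at hsum
  have hpos : 0 < P * (2 * s + 1) := Nat.mul_pos Fintype.card_pos (Nat.succ_pos _)
  refine Nat.le_of_mul_le_mul_left ?_ hpos
  calc P * (2 * s + 1) * (∑ r ∈ range s, #(F r) + (s + 1) * #(F s))
      = ∑ r ∈ range s, P * (2 * s + 1) * #(F r) + (s + 1) * (P * (2 * s + 1) * #(F s)) := by
        rw [mul_add, mul_sum]; ring
    _ = (∑ r ∈ range s, ∑ σ : Equiv.Perm α, #{j | (B j).map σ.toEmbedding ∈ F r} +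
          (s + 1) * ∑ σ : Equiv.Perm α, #{j | (B j).map σ.toEmbedding ∈ F s}) * c := by
        simp only [← havg]
        rw [← sum_mul]
        ring
    _ ≤ P * (s * (2 * s + 1)) * c := Nat.mul_le_mul_right _ hsum
    _ = P * (2 * s + 1) * (s * c) := by ring

/-! ### The bound for shifted families -/

theorem card_eq_card_filter_add_add {β : Type*} (X : Finset β) (c : β → ℕ) :
    #X = #{x ∈ X | 2 ≤ c x} + #{x ∈ X | c x = 1} + #{x ∈ X | c x = 0} := by
  simp only [card_filter, card_eq_sum_ones X, ← sum_add_distrib]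
  refine sum_congr rfl fun x _ => ?_
  split_ifs <;> omega

theorem exists_map_addRight_eq {a m : ℕ} {C : Finset ℕ} (hC : C ⊆ Ico a (a + m)) :
    ∃ B : Finset (Fin m), B.map (Fin.valEmbedding.trans (addRightEmbedding a)) = C := by
  refine ⟨univ.filter fun x => (x : ℕ) + a ∈ C, ?_⟩
  ext y
  simp only [mem_map, mem_filter, mem_univ, true_and, Function.Embedding.trans_apply,
    Fin.valEmbedding_apply, addRightEmbedding_apply]
  constructor
  · rintro ⟨x, hx, rfl⟩
    exact hx
  · intro hy
    have := mem_Ico.1 (hC hy)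
    exact ⟨⟨y - a, by omega⟩, by simpa [Nat.sub_add_cancel this.1] using hy, by simp [this.1]⟩

/-- Frankl's bound for shifted families without `s + 1` pairwise disjoint members. -/
theorem ShiftedFrom.card_le {n l s : ℕ} {𝒜 : Finset (Finset ℕ)}
    (hsh : ShiftedFrom 0 𝒜) (h𝒜 : 𝒜 ⊆ (range n).powersetCard (l + 1))
    (hm : ¬ HasMatching 𝒜 (s + 1)) (hn : (2 * s + 1) * (l + 1) ≤ n) :
    #𝒜 ≤ #{A ∈ (range n).powersetCard (l + 1) | ¬ Disjoint (range s) A} := by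
  have hexp : (2 * s + 1) * (l + 1) = (2 * s + 1) * l + (2 * s + 1) := by ring
  -- The `m` points outside `R` still have room for `2 * s + 1` disjoint `l`-sets.
  obtain ⟨m, rfl⟩ := Nat.exists_eq_add_of_le (show s + 1 ≤ n by omega)
  have hml : (2 * s + 1) * l ≤ m := by omega
  set R := range (s + 1) with hR
  set e : Fin m ↪ ℕ := Fin.valEmbedding.trans (addRightEmbedding (s + 1)) with he
  have hmap : ∀ (B : Finset (Fin m)), ∀ x ∈ B.map e, s < x ∧ x < s + 1 + m := by
    intro B x hx
    obtain ⟨y, _, rfl⟩ := mem_map.1 hx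
    simp only [he, Function.Embedding.trans_apply, Fin.valEmbedding_apply,
      addRightEmbedding_apply]
    omega
  have hnot : ∀ r ≤ s, ∀ B : Finset (Fin m), r ∉ B.map e := fun r hr B h =>
    absurd (hmap B r h).1 (not_lt.2 hr)
  have hinter : ∀ r ≤ s, ∀ B : Finset (Fin m), insert r (B.map e) ∩ R = {r} := by
    intro r hr B
    ext x
    simp only [mem_inter, mem_insert, hR, mem_range, mem_singleton]
    constructor
    · rintro ⟨h | h, hx⟩
      · exact h
      · have := hmap B x h
        omega
    · rintro rfl
      exact ⟨Or.inl rfl, by omega⟩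
  -- The condition `r ≤ s` empties the sequence beyond `s`, so that it decreases on all of `ℕ`.
  set F : ℕ → Finset (Finset (Fin m)) := fun r =>
    {B ∈ univ.powersetCard l | r ≤ s ∧ insert r (B.map e) ∈ 𝒜} with hF
  have hanti : Antitone F := by
    intro r r' hrr B hB
    obtain ⟨hB, hr, hBA⟩ := mem_filter.1 hB
    refine mem_filter.2 ⟨hB, hrr.trans hr, ?_⟩
    rcases hrr.eq_or_lt with rfl | hlt
    · exact hBA
    · have := hsh _ hBA r r' (Nat.zero_le _) hlt (mem_insert_self _ _)
        (by simp only [mem_insert, not_or]; exact ⟨hlt.ne, hnot r (by omega) B⟩)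
      rwa [erase_insert (hnot r' hr B)] at this
  have hmain := sum_card_add_mul_card_le (s := s) (l := l) (by simpa using hml) hanti
    (fun r => filter_subset _ _) (by
      rintro ⟨f, hf, hd⟩
      refine hm ⟨fun i => insert (i : ℕ) ((f i).map e), fun i => ?_, fun i j hij => ?_⟩
      · exact (mem_filter.1 (hf i)).2.2
      · have hne : (j : ℕ) ≠ i := fun h => hij (Fin.ext h.symm)
        simp only [disjoint_insert_left, disjoint_insert_right, mem_insert, not_or]
        exact ⟨⟨hne, hnot _ (by omega) _⟩, hnot _ (by omega) _, (disjoint_map e).2 (hd hij)⟩)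
  rw [Fintype.card_fin] at hmain
  set E := {A ∈ (range (s + 1 + m)).powersetCard (l + 1) | ¬ Disjoint (range s) A} with hE
  have hbd : ∀ A ∈ 𝒜, ∀ x ∈ A, x < s + 1 + m := fun A hA x hx =>
    mem_range.1 ((mem_powersetCard.1 (h𝒜 hA)).1 hx)
  -- Of two points of `R`, at least one differs from `s` and so lies in `range s`.
  have htwo : #{A ∈ 𝒜 | 2 ≤ #(A ∩ R)} ≤ #{A ∈ E | 2 ≤ #(A ∩ R)} := by
    refine card_le_card fun A hA => ?_
    obtain ⟨hA, h2⟩ := mem_filter.1 hA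
    refine mem_filter.2 ⟨mem_filter.2 ⟨h𝒜 hA, fun hd => ?_⟩, h2⟩
    have : A ∩ R ⊆ {s} := by
      intro x hx
      obtain ⟨hxA, hxR⟩ := mem_inter.1 hx
      have h1 : x ∉ range s := fun h => disjoint_left.1 hd h hxA
      rw [mem_range] at h1
      rw [hR, mem_range] at hxR
      exact mem_singleton.2 (by omega)
    have := card_le_card this
    rw [card_singleton] at this
    omega
  have hone : #{A ∈ 𝒜 | #(A ∩ R) = 1} ≤ ∑ r ∈ range (s + 1), #(F r) := by
    have hsub : {A ∈ 𝒜 | #(A ∩ R) = 1} ⊆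
        (range (s + 1)).biUnion fun r => (F r).image fun B => insert r (B.map e) := by
      intro A hA
      obtain ⟨hA, h1⟩ := mem_filter.1 hA
      obtain ⟨r, hr⟩ := card_eq_one.1 h1
      obtain ⟨hrA, hrR⟩ := mem_inter.1 (hr ▸ mem_singleton_self r : r ∈ A ∩ R)
      obtain ⟨B, hB⟩ := exists_map_addRight_eq (a := s + 1) (m := m) (C := A.erase r) (by
        intro x hx
        obtain ⟨hxr, hxA⟩ := mem_erase.1 hx
        refine mem_Ico.2 ⟨?_, hbd A hA x hxA⟩
        by_contra hlt
        refine hxr (mem_singleton.1 (hr ▸ mem_inter.2 ⟨hxA, ?_⟩))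
        exact mem_range.2 (by omega))
      have hcB : #B = l := by
        rw [← card_map (Fin.valEmbedding.trans (addRightEmbedding (s + 1))), hB,
          card_erase_of_mem hrA, (mem_powersetCard.1 (h𝒜 hA)).2]
        omega
      have hins : insert r (B.map e) = A := by rw [he, hB, insert_erase hrA]
      refine mem_biUnion.2 ⟨r, hrR, mem_image.2 ⟨B, mem_filter.2 ⟨?_, ?_, ?_⟩, hins⟩⟩
      · exact mem_powersetCard.2 ⟨subset_univ _, hcB⟩
      · have := mem_range.1 hrR
        omega
      · rwa [hins]
    exact (card_le_card hsub).trans (card_biUnion_le.trans (sum_le_sum fun _ _ => card_image_le))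
  have hzero : #{A ∈ 𝒜 | #(A ∩ R) = 0} ≤ s * #(F s) := by
    set G := {A ∈ 𝒜 | #(A ∩ R) = 0} with hG
    have hGR : ∀ A, A ∈ G ↔ A ∈ 𝒜 ∧ ∀ x ∈ A, s < x := by
      intro A
      simp only [hG, mem_filter, card_eq_zero, hR, eq_empty_iff_forall_notMem, mem_inter,
        mem_range, not_and, not_lt, Nat.succ_le_iff]
    have hGsub : G ⊆ (Ico (s + 1) (s + 1 + m)).powersetCard (l + 1) := by
      intro A hA
      obtain ⟨hA, h⟩ := (hGR A).1 hA
      exact mem_powersetCard.2 ⟨fun x hx => mem_Ico.2 ⟨h x hx, hbd A hA x hx⟩,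
        (mem_powersetCard.1 (h𝒜 hA)).2⟩
    have hGsh : ShiftedFrom (s + 1) G := by
      intro A hA i j hai hij hj hi
      obtain ⟨hA, h⟩ := (hGR A).1 hA
      refine (hGR _).2 ⟨hsh A hA i j (Nat.zero_le _) hij hj hi, fun x hx => ?_⟩
      rcases mem_insert.1 hx with rfl | hx
      · omega
      · exact h x (mem_of_mem_erase hx)
    refine (card_le_mul_card_shadow m hGsub hGsh
      fun h => hm (h.mono (filter_subset _ _))).trans (Nat.mul_le_mul_left _ ?_)
    have hsub : G.shadow ⊆ (F s).image fun B => B.map e := by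
      intro D hD
      obtain ⟨x, hxD, hx⟩ := mem_shadow_iff_insert_mem.1 hD
      have hDc := mem_powersetCard.1 (hGsub hx)
      obtain ⟨B, hB⟩ := exists_map_addRight_eq ((subset_insert x D).trans hDc.1)
      obtain ⟨hx, hsx⟩ := (hGR _).1 hx
      have hsD : s ∉ insert x D := fun h => lt_irrefl s (hsx s h)
      -- The deleted point `x` is shifted down to `s`, which puts the shadow set in the link of `s`.
      have := hsh _ hx s x (Nat.zero_le _) (hsx x (mem_insert_self _ _)) (mem_insert_self _ _) hsD
      rw [erase_insert hxD, ← hB] at this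
      refine mem_image.2 ⟨B, mem_filter.2 ⟨mem_powersetCard.2 ⟨subset_univ _, ?_⟩, le_rfl, this⟩,
        hB⟩
      have h2 := hDc.2
      rw [card_insert_of_notMem hxD, ← hB, card_map] at h2
      omega
    exact (card_le_card hsub).trans card_image_le
  have hstar : s * m.choose l ≤ #{A ∈ E | #(A ∩ R) = 1} := by
    have hsub : ((range s).biUnion fun r =>
        (univ.powersetCard l).image fun B : Finset (Fin m) => insert r (B.map e)) ⊆
        {A ∈ E | #(A ∩ R) = 1} := by
      intro A hA
      obtain ⟨r, hr, hA⟩ := mem_biUnion.1 hA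
      obtain ⟨B, hB, rfl⟩ := mem_image.1 hA
      have hrs := mem_range.1 hr
      refine mem_filter.2 ⟨mem_filter.2 ⟨mem_powersetCard.2 ⟨?_, ?_⟩, ?_⟩, ?_⟩
      · refine insert_subset (mem_range.2 (by omega)) fun x hx => mem_range.2 (hmap B x hx).2
      · rw [card_insert_of_notMem (hnot r hrs.le B), card_map, (mem_powersetCard.1 hB).2]
      · exact not_disjoint_iff.2 ⟨r, hr, mem_insert_self _ _⟩
      · rw [hinter r hrs.le, card_singleton]
    refine le_trans (le_of_eq ?_) (card_le_card hsub)
    rw [card_biUnion]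
    · rw [sum_congr rfl fun r hr => ?_, sum_const, card_range, smul_eq_mul]
      rw [card_image_of_injective, card_powersetCard, card_univ, Fintype.card_fin]
      intro B B' h
      have hr' := (mem_range.1 hr).le
      have := congrArg (fun C : Finset ℕ => C.erase r) h
      simp only [erase_insert (hnot r hr' _)] at this
      exact map_injective _ this
    · intro r hr r' hr' hne
      refine disjoint_left.2 fun A hA hA' => hne ?_
      obtain ⟨B, _, rfl⟩ := mem_image.1 hA
      obtain ⟨B', _, h⟩ := mem_image.1 hA'
      have h1 := hinter r (mem_range.1 hr).le B
      rw [← h, hinter r' (mem_range.1 hr').le B'] at h1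
      exact (singleton_injective h1).symm
  rw [sum_range_succ] at hone
  rw [card_eq_card_filter_add_add 𝒜 fun A => #(A ∩ R),
    card_eq_card_filter_add_add E fun A => #(A ∩ R)]
  have : (s + 1) * #(F s) = s * #(F s) + #(F s) := by ring
  omega

/-! ### Arbitrary families and the Kneser graph -/

theorem card_filter_not_disjoint_add_choose {α : Type*} [DecidableEq α] {S U : Finset α}
    (h : S ⊆ U) (k : ℕ) :
    #{A ∈ U.powersetCard k | ¬ Disjoint S A} + (#U - #S).choose k = (#U).choose k := by
  have h1 : {A ∈ U.powersetCard k | Disjoint S A} = (U \ S).powersetCard k := by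
    ext A
    simp only [mem_filter, mem_powersetCard, subset_sdiff, disjoint_comm (a := S)]
    tauto
  rw [← card_sdiff_of_subset h, ← card_powersetCard, ← h1, add_comm,
    card_filter_add_card_filter_not, card_powersetCard]

/-- A family of `k`-subsets of an `n`-set, `(2 * s + 1) * k ≤ n`, that has more members than a
union of `s` stars contains `s + 1` pairwise disjoint sets. -/
theorem hasMatching_of_choose_lt {n k s : ℕ} (hk : 0 < k) (hn : (2 * s + 1) * k ≤ n)
    {F : Finset (Finset (Fin n))} (hF : F ⊆ univ.powersetCard k)
    (hlt : n.choose k < #F + (n - s).choose k) : HasMatching F (s + 1) := by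
  obtain ⟨l, rfl⟩ : ∃ l, k = l + 1 := ⟨k - 1, by omega⟩
  by_contra hm
  set 𝒜 := F.map (mapEmbedding Fin.valEmbedding).toEmbedding with h𝒜
  have hsub : 𝒜 ⊆ (range n).powersetCard (l + 1) := by
    intro A hA
    obtain ⟨B, hB, rfl⟩ := mem_map.1 hA
    refine mem_powersetCard.2 ⟨fun x hx => ?_, ?_⟩
    · obtain ⟨y, _, rfl⟩ := mem_map.1 hx
      exact mem_range.2 y.2
    · exact (card_map _).trans (mem_powersetCard.1 (hF hB)).2
  have hm' : ¬ HasMatching 𝒜 (s + 1) := by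
    rintro ⟨f, hf, hd⟩
    choose g hg hgf using fun i => mem_map.1 (hf i)
    refine hm ⟨g, hg, fun i j hij => ?_⟩
    have : Disjoint (f i) (f j) := hd hij
    rw [← hgf i, ← hgf j] at this
    exact (disjoint_map _).1 this
  obtain ⟨ℬ, hℬ, hno, hcard, hsh⟩ := exists_shiftedFrom hsub hm'
  have h1 := hsh.card_le hℬ hno hn
  have hsn : s ≤ n := by nlinarith
  have h2 := card_filter_not_disjoint_add_choose (range_subset_range.2 hsn) (l + 1)
  rw [card_range, card_range] at h2
  rw [hcard, h𝒜, card_map] at h1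
  omega

/-- Only the empty set is disjoint from itself, so without it an indexed matching is injective and
its image has `m` elements. -/
theorem HasMatching.exists_image {α : Type*} [DecidableEq α] {F : Finset (Finset α)} {m : ℕ}
    (h : HasMatching F m) (hF : ∅ ∉ F) :
    ∃ M ⊆ F, #M = m ∧ ∀ A ∈ M, ∀ B ∈ M, A ≠ B → Disjoint A B := by
  obtain ⟨f, hf, hd⟩ := h
  have hinj : Function.Injective f := by
    intro i j hij
    by_contra hne
    have : Disjoint (f i) (f j) := hd hne
    rw [hij, disjoint_self] at this
    exact hF ((show f j = ∅ from this) ▸ hf j)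
  refine ⟨univ.image f, fun A hA => ?_, by rw [card_image_of_injective _ hinj]; simp, ?_⟩
  · obtain ⟨i, _, rfl⟩ := mem_image.1 hA
    exact hf i
  · intro A hA B hB hne
    obtain ⟨i, _, rfl⟩ := mem_image.1 hA
    obtain ⟨j, _, rfl⟩ := mem_image.1 hB
    exact hd fun h => hne (congrArg f h)

theorem mainTheorem4 (n k s : ℕ) (hk : 0 < k) (hs : 0 < s) (hn : 10000 * s ^ 5 * k ≤ n)
    (F : Finset (Finset (Fin n))) (hF : F ⊆ Finset.univ.powersetCard k)
    (S : Finset (Fin n)) (hS : S.card = s) (hlarge : (unionOfStars n k S).card < F.card) :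
    (∃ M : Finset (Finset (Fin n)), M ⊆ F ∧ M.card = s + 1 ∧ IsMatchingFamily M) ∧
      ∃ T : Finset {v : {A : Finset (Fin n) // A.card = k} | v.1 ∈ F},
        ((kneserGraph n k).induce {v | v.1 ∈ F}).IsNClique (s + 1) T := by
  have hn' : (2 * s + 1) * k ≤ n := by
    refine le_trans (Nat.mul_le_mul_right _ ?_) hn
    have := Nat.le_self_pow (n := 5) (by norm_num) s
    omega
  have hstars : unionOfStars n k S = {A ∈ (univ : Finset (Fin n)).powersetCard k | ¬ Disjoint S A} := by
    ext A
    simp only [unionOfStars, kneserStar, mem_biUnion, mem_filter, not_disjoint_iff]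
    tauto
  have hchoose := card_filter_not_disjoint_add_choose (subset_univ S) k
  rw [← hstars, hS, card_univ, Fintype.card_fin] at hchoose
  have hcard : ∀ A ∈ F, #A = k := fun A hA => (mem_powersetCard.1 (hF hA)).2
  obtain ⟨M, hMF, hMc, hM⟩ := (hasMatching_of_choose_lt hk hn' hF (by omega)).exists_image
    fun h => by simpa [hk.ne] using hcard _ h
  refine ⟨⟨M, hMF, hMc, hM⟩, ?_⟩
  let φ : {A // A ∈ M} ↪ {v : {A : Finset (Fin n) // A.card = k} | v.1 ∈ F} :=
    ⟨fun A => ⟨⟨A.1, hcard _ (hMF A.2)⟩, hMF A.2⟩, fun A B h =>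
      Subtype.ext (congrArg (fun v => v.1.1) h)⟩
  refine ⟨M.attach.map φ, ?_, by rw [card_map, card_attach, hMc]⟩
  intro v hv w hw hvw
  obtain ⟨A, _, rfl⟩ := mem_map.1 (mem_coe.1 hv)
  obtain ⟨B, _, rfl⟩ := mem_map.1 (mem_coe.1 hw)
  have hne : A.1 ≠ B.1 := fun h => hvw (congrArg φ (Subtype.ext h))
  exact ⟨fun h => hne (congrArg (fun v => v.1) h), hM _ A.2 _ B.2 hne⟩
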